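/- Let $n \ge 2$ be an integer and let $\Omega_n = |B(0,1)|$ denote the Lebesgue measure of the unit ball of $\mathbf{R}^n$. Definitions. Let $\Omega \subset \mathbf{R}^n$ be open and bounded. For a measurable $f$ on $\Omega$ with values in $\mathbf{R}$ or $\mathbf{R}^n$ put $$f^{*}(t) = \inf\{v \ge 0 : |\{x \in \Omega : |f(x)| > v\}| \le t\}, \qquad f^{**}(t) = \frac1t \int_0^t f^{*}(s)\,ds,$$ $$\|f\|_{L^{n,1}(\Omega)} = \int_0^\infty t^{1/n} f^{*}(t)\,\frac{dt}{t}, \qquad \|f\|_{L^{(n,1)}(\Omega)} = \int_0^\infty t^{1/n} f^{**}(t)\,\frac{dt}{t}.$$ Let $H_0^{1,(n,1)}(\Omega)$ be the closure of $C_0^\infty(\Omega)$ in the norm $\|u\|_{L^{(n,1)}(\Omega)} + \|\nabla u\|_{L^{(n,1)}(\Omega)}$; it consists of (classes of) functions $u$ with distributional gradient $\nabla u$. For $E \subset \Omega$ the $n,1$ relative capacity of the condenser $(E,\Omega)$ is $$\mathrm{cap}_{n,1}(E,\Omega) = \inf\{\|\nabla u\|_{L^{n,1}(\Omega)}^{n}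 : u \in H_0^{1,(n,1)}(\Omega),\ u \ge 1 \text{ a.e. in a neighborhood of } E\},$$ with $\inf\emptyset = \infty$. Theorem. (i) For every $0 \le r < 1$, $$n^n \Omega_n (1-r^n)^{1-n} \le \mathrm{cap}_{n,1}(\overline{B}(0,r), B(0,1)) \le n^n \Omega_n \frac{1-r^n}{(1-r)^n},$$ where $\overline{B}(0,r) = \{x : |x| \le r\}$ (so $\overline{B}(0,0)=\{0\}$) and $B(0,1)=\{x : |x|<1\}$. (ii) For every $x \in \mathbf{R}^n$ and every bounded open set $\Omega \subset \mathbf{R}^n$ containing $x$, $$\mathrm{cap}_{n,1}(\{x\}, \Omega) = n^n \Omega_n.$$ -/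

import Mathlib

open MeasureTheory Set Filter Topology
open scoped ENNReal

namespace SobolevLorentz

noncomputable section

/-- Euclidean space `ℝⁿ`. -/
abbrev E (n : ℕ) : Type := EuclideanSpace ℝ (Fin n)

/-- The Lebesgue measure `Ω_n` of the unit ball of `ℝⁿ`. -/
def unitBallVolume (n : ℕ) : ℝ := volume.real (Metric.ball (0 : E n) 1)

/-- The distribution function `λ_f(t) = |{x ∈ Ω : |f(x)| > t}|` of a scalar or vector valued `f`. -/
def distribution {n : ℕ} {F : Type*} [NormedAddCommGroup F]
    (Ω : Set (E n)) (f : E n → F) (t : ℝ≥0∞) : ℝ≥0∞ :=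
  volume {x | x ∈ Ω ∧ t < ‖f x‖ₑ}

/-- The nonincreasing rearrangement `f*(t) = inf {v : λ_f(v) ≤ t}`. -/
def rearrangement {n : ℕ} {F : Type*} [NormedAddCommGroup F]
    (Ω : Set (E n)) (f : E n → F) (t : ℝ) : ℝ≥0∞ :=
  sInf {v : ℝ≥0∞ | distribution Ω f v ≤ ENNReal.ofReal t}

/-- The maximal function `f**(t) = (1/t) ∫_0^t f*(s) ds`. -/
def maximalRearrangement {n : ℕ} {F : Type*} [NormedAddCommGroup F]
    (Ω : Set (E n)) (f : E n → F) (t : ℝ) : ℝ≥0∞ :=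
  (∫⁻ s in Ioc 0 t, rearrangement Ω f s) / ENNReal.ofReal t

/-- The Lorentz `p,q`-quasinorm on `Ω` (for finite `q`):
`(∫_0^∞ (t^{1/p} f*(t))^q dt/t)^{1/q}`. -/
def lorentzQuasinorm {n : ℕ} {F : Type*} [NormedAddCommGroup F]
    (p q : ℝ) (Ω : Set (E n)) (f : E n → F) : ℝ≥0∞ :=
  (∫⁻ t in Ioi (0 : ℝ),
    (ENNReal.ofReal t ^ (1 / p) * rearrangement Ω f t) ^ q / ENNReal.ofReal t) ^ (1 / q)

/-- The Lorentz `(p,q)`-norm on `Ω` (for finite `q`):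
`(∫_0^∞ (t^{1/p} f**(t))^q dt/t)^{1/q}`. -/
def lorentzNorm {n : ℕ} {F : Type*} [NormedAddCommGroup F]
    (p q : ℝ) (Ω : Set (E n)) (f : E n → F) : ℝ≥0∞ :=
  (∫⁻ t in Ioi (0 : ℝ),
    (ENNReal.ofReal t ^ (1 / p) * maximalRearrangement Ω f t) ^ q / ENNReal.ofReal t) ^ (1 / q)

/-- The Sobolev-Lorentz `(p,q)`-norm of a function `u` with gradient `v`:
`(‖u‖_{(p,q)}^r + ‖v‖_{(p,q)}^r)^{1/r}` with `r = min(p,q)`. -/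
def sobolevLorentzNorm {n : ℕ} (p q : ℝ) (Ω : Set (E n)) (u : E n → ℝ) (v : E n → E n) : ℝ≥0∞ :=
  (lorentzNorm p q Ω u ^ min p q + lorentzNorm p q Ω v ^ min p q) ^ (1 / min p q)

/-- `φ ∈ C_0^∞(Ω)`, extended by zero to `ℝⁿ`. -/
def IsTestFunction {n : ℕ} (Ω : Set (E n)) (φ : E n → ℝ) : Prop :=
  ContDiff ℝ ((⊤ : ℕ∞) : WithTop ℕ∞) φ ∧ HasCompactSupport φ ∧ tsupport φ ⊆ Ω

/-- `v` is the distributional gradient of `u` on `Ω`. -/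
def IsWeakGradient {n : ℕ} (Ω : Set (E n)) (u : E n → ℝ) (v : E n → E n) : Prop :=
  LocallyIntegrableOn u Ω ∧ LocallyIntegrableOn v Ω ∧
    ∀ φ : E n → ℝ, IsTestFunction Ω φ → ∀ i : Fin n,
      ∫ x in Ω, φ x * v x i = - ∫ x in Ω, gradient φ x i * u x

/-- `u ∈ H_0^{1,(p,q)}(Ω)` with distributional gradient `v`: the pair `(u, v)` is the limit of
`(φ_k, ∇φ_k)`, `φ_k ∈ C_0^∞(Ω)`, in the Sobolev-Lorentz `(p,q)`-norm.  Only the values of `u` and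
`v` on `Ω` matter, up to null sets. -/
def MemH01 {n : ℕ} (p q : ℝ) (Ω : Set (E n)) (u : E n → ℝ) (v : E n → E n) : Prop :=
  IsWeakGradient Ω u v ∧
    lorentzNorm p q Ω u < ∞ ∧ lorentzNorm p q Ω v < ∞ ∧
    ∃ φ : ℕ → E n → ℝ, (∀ k, IsTestFunction Ω (φ k)) ∧
      Tendsto (fun k => sobolevLorentzNorm p q Ω (φ k - u) (gradient (φ k) - v)) atTop (𝓝 0)

/-- `u`, with distributional gradient `v`, is admissible for the condenser `(A, Ω)`:
`u ∈ H_0^{1,(p,q)}(Ω)` and `u ≥ 1` (almost everywhere) in a neighbourhood of `A`. -/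
def IsAdmissible {n : ℕ} (p q : ℝ) (A Ω : Set (E n)) (u : E n → ℝ) (v : E n → E n) : Prop :=
  MemH01 p q Ω u v ∧
    ∃ U : Set (E n), IsOpen U ∧ A ⊆ U ∧ U ⊆ Ω ∧ ∀ᵐ x, x ∈ U → 1 ≤ u x

/-- The Sobolev-Lorentz `p,q` relative capacity
`cap_{p,q}(A, Ω) = inf {‖∇u‖_{p,q}^p : u admissible for (A, Ω)}`, equal to `∞` if there is no
admissible function. -/
def relCapacity {n : ℕ} (p q : ℝ) (A Ω : Set (E n)) : ℝ≥0∞ :=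
  sInf {c : ℝ≥0∞ | ∃ (u : E n → ℝ) (v : E n → E n),
    IsAdmissible p q A Ω u v ∧ c = lorentzQuasinorm p q Ω v ^ p}

end

end SobolevLorentz

/-! Write ω for the unit ball volume, w(x) = |x - c|^(1-n). Lower bound: an admissible u falls from
at least 1 near the ball to 0 along almost every ray from c, so |∇u| has integral at least 1 along
it. Since w cancels the polar Jacobian, integrating over directions gives ∫ |∇u| w ≥ nω outside the
ball (`le_setLIntegral_of_isAdmissible`). Conversely, a layer cake in |∇u| reduces this integral to
∫_A w over superlevel sets A, and the annulus of the same volume ω(R^n - r^n) is extremal, with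
value nω(R - r). If (R - r)^n ≤ κ(R^n - r^n) for all volumes available in Ω, then ∫ |∇u| w ≤
ω^(1-1/n) κ^(1/n) ‖∇u‖_{n,1} (`setLIntegral_enorm_mul_radialWeight_le`). Together, ‖∇u‖_{n,1}^n ≥
n^n ω / κ.

Upper bound: a smooth radial cutoff of slope L > 1/(ρ - r), supported in a ball of radius less than
ρ and constant on the inner ball, has gradient at most L on a set of volume at most ω(ρ^n - r^n);
let L decrease to 1/(ρ - r).

For r = 0 one may take κ = 1 and the upper bound does not depend on ρ, so the two bounds agree in
every Ω. -/

namespace SobolevLorentz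

/-! ### Rearrangements and Lorentz norms with second index 1. -/

section Lorentz

variable {n : ℕ} {F : Type*} [NormedAddCommGroup F] {Ω : Set (E n)} {f : E n → F}

theorem antitone_distribution : Antitone (distribution Ω f) := fun _ _ hst =>
  measure_mono fun _ hx => ⟨hx.1, hst.trans_lt hx.2⟩

theorem distribution_le_volume (t : ℝ≥0∞) : distribution Ω f t ≤ volume Ω :=
  measure_mono fun _ hx => hx.1

theorem antitone_rearrangement : Antitone (rearrangement Ω f) := fun _ _ hst =>
  sInf_le_sInf fun _ hv => hv.trans (ENNReal.ofReal_le_ofReal hst)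

theorem le_rearrangement {t : ℝ} {s : ℝ≥0∞} (h : ENNReal.ofReal t < distribution Ω f s) :
    s ≤ rearrangement Ω f t :=
  le_sInf fun _ hv => le_of_not_gt fun hvs =>
    absurd (h.trans_le ((antitone_distribution hvs.le).trans hv)) (lt_irrefl _)

theorem rearrangement_le_of_distribution_le {t : ℝ} {v : ℝ≥0∞}
    (h : distribution Ω f v ≤ ENNReal.ofReal t) : rearrangement Ω f t ≤ v :=
  sInf_le h

theorem rearrangement_le_of_enorm_le {L : ℝ≥0∞} (h : ∀ x ∈ Ω, ‖f x‖ₑ ≤ L) (t : ℝ) :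
    rearrangement Ω f t ≤ L := by
  refine rearrangement_le_of_distribution_le ?_
  have : {x | x ∈ Ω ∧ L < ‖f x‖ₑ} = ∅ := by
    ext x
    simpa using fun hx => h x hx
  simp [distribution, this]

theorem rearrangement_eq_zero {m t : ℝ} (hmt : m ≤ t)
    (hsupp : volume {x | x ∈ Ω ∧ f x ≠ 0} ≤ ENNReal.ofReal m) : rearrangement Ω f t = 0 := by
  refine le_antisymm (rearrangement_le_of_distribution_le ?_) bot_le
  simpa [distribution] using hsupp.trans (ENNReal.ofReal_le_ofReal hmt)

theorem rearrangement_le_maximalRearrangement {t : ℝ} (ht : 0 < t) :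
    rearrangement Ω f t ≤ maximalRearrangement Ω f t := by
  rw [maximalRearrangement, ENNReal.le_div_iff_mul_le (by simp [ht]) (by simp)]
  calc rearrangement Ω f t * ENNReal.ofReal t
      = ∫⁻ _ in Ioc 0 t, rearrangement Ω f t := by simp
    _ ≤ _ := setLIntegral_mono' measurableSet_Ioc fun s hs => antitone_rearrangement hs.2

theorem lorentzQuasinorm_one_right (p : ℝ) :
    lorentzQuasinorm p 1 Ω f =
      ∫⁻ t in Ioi (0 : ℝ), ENNReal.ofReal t ^ (1 / p) / ENNReal.ofReal t * rearrangement Ω f t := by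
  simp only [lorentzQuasinorm, ENNReal.rpow_one, div_one]
  refine lintegral_congr fun t => ?_
  rw [ENNReal.mul_div_right_comm]

theorem lorentzNorm_one_right (p : ℝ) :
    lorentzNorm p 1 Ω f =
      ∫⁻ t in Ioi (0 : ℝ),
        ENNReal.ofReal t ^ (1 / p) / ENNReal.ofReal t * maximalRearrangement Ω f t := by
  simp only [lorentzNorm, ENNReal.rpow_one, div_one]
  refine lintegral_congr fun t => ?_
  rw [ENNReal.mul_div_right_comm]

theorem lorentzQuasinorm_le_lorentzNorm (p : ℝ) :
    lorentzQuasinorm p 1 Ω f ≤ lorentzNorm p 1 Ω f := by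
  rw [lorentzQuasinorm_one_right, lorentzNorm_one_right]
  refine setLIntegral_mono' measurableSet_Ioi fun t ht => ?_
  gcongr
  exact rearrangement_le_maximalRearrangement ht

theorem ofReal_rpow_div_ofReal (p : ℝ) {t : ℝ} (ht : 0 < t) :
    ENNReal.ofReal t ^ (1 / p) / ENNReal.ofReal t = ENNReal.ofReal (t ^ (1 / p - 1)) := by
  rw [ENNReal.ofReal_rpow_of_pos ht, ← ENNReal.ofReal_div_of_pos ht, Real.rpow_sub_one ht.ne']

/-- The measure of `(0, m)` with respect to `t ^ (1 / p) dt / t` is `p * m ^ (1 / p)`. -/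
theorem setLIntegral_Ioo_rpow {p : ℝ} (hp : 0 < p) {m : ℝ} (hm : 0 ≤ m) :
    ∫⁻ t in Ioo 0 m, ENNReal.ofReal t ^ (1 / p) / ENNReal.ofReal t =
      ENNReal.ofReal (p * m ^ (1 / p)) := by
  have hp' : -1 < 1 / p - 1 := by
    have : 0 < 1 / p := by positivity
    linarith
  rw [setLIntegral_congr_fun measurableSet_Ioo fun t ht => ofReal_rpow_div_ofReal p ht.1,
    setLIntegral_congr Ioo_ae_eq_Ioc, ← ofReal_integral_eq_lintegral_ofReal,
    ← intervalIntegral.integral_of_le hm, integral_rpow (Or.inl hp')]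
  · congr 1
    have : (1 / p) ≠ 0 := by positivity
    rw [sub_add_cancel, Real.zero_rpow this]
    field_simp
    simp
  · exact (intervalIntegral.intervalIntegrable_rpow' hp').1
  · filter_upwards [ae_restrict_mem measurableSet_Ioc] with t ht
    exact Real.rpow_nonneg ht.1.le _

theorem measurable_lorentz_weight (p : ℝ) :
    Measurable fun t : ℝ => ENNReal.ofReal t ^ (1 / p) / ENNReal.ofReal t := by
  fun_prop

/-- The layer cake lower bound for the `p, 1` quasinorm. -/
theorem lintegral_distribution_rpow_le {p : ℝ} (hp : 0 < p) (hΩ : volume Ω ≠ ∞) :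
    ∫⁻ s in Ioi (0 : ℝ), ENNReal.ofReal p * distribution Ω f (ENNReal.ofReal s) ^ (1 / p) ≤
      lorentzQuasinorm p 1 Ω f := by
  set w : ℝ → ℝ≥0∞ := fun t => ENNReal.ofReal t ^ (1 / p) / ENNReal.ofReal t with hw
  have hwm : Measurable w := measurable_lorentz_weight p
  set D : ℝ → ℝ≥0∞ := fun s => distribution Ω f (ENNReal.ofReal s) with hD
  have hDm : Measurable D :=
    Antitone.measurable fun s t hst => antitone_distribution (ENNReal.ofReal_le_ofReal hst)
  have hS : MeasurableSet {z : ℝ × ℝ | ENNReal.ofReal z.2 < D z.1} :=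
    measurableSet_lt (by fun_prop) (by fun_prop)
  -- Tonelli for the weight on {(s, t) : t < D s}: integrating in t first gives p * D(s)^(1/p),
  -- while each slice at fixed t lies in (0, f*(t)].
  have inner : ∀ s, ENNReal.ofReal p * D s ^ (1 / p) =
      ∫⁻ t in Ioi (0 : ℝ), {z : ℝ × ℝ | ENNReal.ofReal z.2 < D z.1}.indicator (fun z => w z.2)
        (s, t) := by
    intro s
    have hfin : D s ≠ ∞ := ((distribution_le_volume _).trans_lt hΩ.lt_top).ne
    have : ENNReal.ofReal p * D s ^ (1 / p) = ∫⁻ t in Ioo 0 (D s).toReal, w t := by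
      rw [setLIntegral_Ioo_rpow hp ENNReal.toReal_nonneg, ENNReal.ofReal_mul hp.le,
        ← ENNReal.ofReal_rpow_of_nonneg ENNReal.toReal_nonneg (by positivity),
        ENNReal.ofReal_toReal hfin]
    rw [this, ← lintegral_indicator measurableSet_Ioo, ← lintegral_indicator measurableSet_Ioi]
    refine lintegral_congr fun t => ?_
    simp only [indicator, mem_Ioo, mem_Ioi, mem_ofPred_eq]
    by_cases ht : 0 < t
    · simp [ht, ENNReal.ofReal_lt_iff_lt_toReal ht.le hfin]
    · simp [ht]
  calc ∫⁻ s in Ioi (0 : ℝ), ENNReal.ofReal p * D s ^ (1 / p)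
      = ∫⁻ s in Ioi (0 : ℝ), ∫⁻ t in Ioi (0 : ℝ),
          {z : ℝ × ℝ | ENNReal.ofReal z.2 < D z.1}.indicator (fun z => w z.2) (s, t) :=
        lintegral_congr fun s => inner s
    _ = ∫⁻ t in Ioi (0 : ℝ), ∫⁻ s in Ioi (0 : ℝ),
          {z : ℝ × ℝ | ENNReal.ofReal z.2 < D z.1}.indicator (fun z => w z.2) (s, t) := by
        refine lintegral_lintegral_swap ?_
        exact ((hwm.comp measurable_snd).indicator hS).aemeasurable
    _ ≤ ∫⁻ t in Ioi (0 : ℝ), w t * rearrangement Ω f t := by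
        refine lintegral_mono fun t => ?_
        have hSt : MeasurableSet {s : ℝ | ENNReal.ofReal t < D s} :=
          measurableSet_lt measurable_const hDm
        calc ∫⁻ s in Ioi (0 : ℝ),
              {z : ℝ × ℝ | ENNReal.ofReal z.2 < D z.1}.indicator (fun z => w z.2) (s, t)
            = ∫⁻ s in Ioi (0 : ℝ), {s : ℝ | ENNReal.ofReal t < D s}.indicator
                (fun _ => w t) s := rfl
          _ = w t * volume ({s : ℝ | ENNReal.ofReal t < D s} ∩ Ioi 0) := by
              rw [lintegral_indicator_const hSt, Measure.restrict_apply hSt]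
          _ ≤ w t * rearrangement Ω f t := by
              gcongr
              by_cases hr : rearrangement Ω f t = ∞
              · simp [hr]
              calc volume ({s : ℝ | ENNReal.ofReal t < D s} ∩ Ioi 0)
                  ≤ volume (Ioc 0 (rearrangement Ω f t).toReal) := by
                    refine measure_mono fun s hs => ⟨hs.2, ?_⟩
                    exact (ENNReal.ofReal_le_iff_le_toReal hr).1 (le_rearrangement hs.1)
                _ = rearrangement Ω f t := by simp [hr]
    _ = _ := (lorentzQuasinorm_one_right p).symm

/-- The rearrangement is dominated by L on (0, m) and vanishes from m on. -/
theorem lorentzQuasinorm_le_of_enorm_le {p : ℝ} (hp : 0 < p) {L m : ℝ} (hL : 0 ≤ L) (hm : 0 ≤ m)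
    (hf : ∀ x ∈ Ω, ‖f x‖ₑ ≤ ENNReal.ofReal L)
    (hsupp : volume {x | x ∈ Ω ∧ f x ≠ 0} ≤ ENNReal.ofReal m) :
    lorentzQuasinorm p 1 Ω f ≤ ENNReal.ofReal (L * (p * m ^ (1 / p))) := by
  rw [lorentzQuasinorm_one_right, ENNReal.ofReal_mul hL, ← setLIntegral_Ioo_rpow hp hm, mul_comm,
    ← lintegral_mul_const _ (measurable_lorentz_weight p),
    ← lintegral_indicator measurableSet_Ioi, ← lintegral_indicator measurableSet_Ioo]
  refine lintegral_mono fun t => ?_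
  simp only [indicator, mem_Ioi, mem_Ioo]
  by_cases ht : 0 < t
  · by_cases htm : t < m
    · simp only [ht, htm, and_self, if_true]
      gcongr
      exact rearrangement_le_of_enorm_le hf t
    · simp [ht, htm, rearrangement_eq_zero (not_lt.1 htm) hsupp]
  · simp [ht]

/-- Near 0, f** ≤ L and the weight t^(1/p - 1) is integrable; for large t, f** ≤ LM/t, and t^(1/p -
2) is integrable at infinity precisely because p > 1. -/
theorem lorentzNorm_lt_top_of_enorm_le {p : ℝ} (hp : 1 < p) {L : ℝ}
    (hf : ∀ x ∈ Ω, ‖f x‖ₑ ≤ ENNReal.ofReal L) (hΩ : volume Ω ≠ ∞) :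
    lorentzNorm p 1 Ω f < ∞ := by
  -- Adding 1 keeps M positive even when Ω is null.
  set M : ℝ := (volume Ω).toReal + 1 with hM
  have hM0 : 0 < M := by positivity
  have hΩM : volume Ω ≤ ENNReal.ofReal M := by
    rw [← ENNReal.ofReal_toReal hΩ]
    exact ENNReal.ofReal_le_ofReal (by simp [hM])
  have hint : ∀ t, ∫⁻ s in Ioc 0 t, rearrangement Ω f s ≤ ENNReal.ofReal L * ENNReal.ofReal M := by
    intro t
    calc ∫⁻ s in Ioc 0 t, rearrangement Ω f s
        ≤ ∫⁻ s in Ioc 0 t, (Ioo 0 M).indicator (fun _ => ENNReal.ofReal L) s := by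
          refine setLIntegral_mono' measurableSet_Ioc fun s hs => ?_
          by_cases hsM : s < M
          · simp only [indicator, mem_Ioo, hs.1, hsM, and_self, if_true]
            exact rearrangement_le_of_enorm_le hf s
          · rw [rearrangement_eq_zero (not_lt.1 hsM)
              ((measure_mono fun x hx => hx.1).trans hΩM)]
            exact zero_le
      _ ≤ ∫⁻ s, (Ioo 0 M).indicator (fun _ => ENNReal.ofReal L) s := setLIntegral_le_lintegral _ _
      _ = _ := by
          rw [lintegral_indicator_const measurableSet_Ioo, Real.volume_Ioo, sub_zero]
  have hmax : ∀ t, 0 < t → maximalRearrangement Ω f t ≤ ENNReal.ofReal L := by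
    intro t ht
    rw [maximalRearrangement]
    refine ENNReal.div_le_of_le_mul ?_
    calc ∫⁻ s in Ioc 0 t, rearrangement Ω f s ≤ ∫⁻ _ in Ioc 0 t, ENNReal.ofReal L :=
          lintegral_mono fun s => rearrangement_le_of_enorm_le hf s
      _ = _ := by simp
  rw [lorentzNorm_one_right, ← Ioo_union_Ici_eq_Ioi hM0]
  refine (lintegral_union_le _ _ _).trans_lt (ENNReal.add_lt_top.2 ⟨?_, ?_⟩)
  · refine lt_of_le_of_lt (b := ENNReal.ofReal (p * M ^ (1 / p)) * ENNReal.ofReal L) ?_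
      (ENNReal.mul_lt_top (by simp) (by simp))
    rw [← setLIntegral_Ioo_rpow (by linarith) hM0.le,
      ← lintegral_mul_const _ (measurable_lorentz_weight p)]
    refine setLIntegral_mono' measurableSet_Ioo fun t ht => ?_
    gcongr
    exact hmax t ht.1
  · have hp' : 1 / p - 2 < -1 := by
      have : 1 / p < 1 := by
        rw [div_lt_one (by linarith)]
        exact hp
      linarith
    calc ∫⁻ t in Ici M, ENNReal.ofReal t ^ (1 / p) / ENNReal.ofReal t * maximalRearrangement Ω f t
        ≤ ∫⁻ t in Ici M, ENNReal.ofReal (t ^ (1 / p - 2)) *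
            (ENNReal.ofReal L * ENNReal.ofReal M) := by
          refine setLIntegral_mono' measurableSet_Ici fun t ht => ?_
          have ht0 : 0 < t := hM0.trans_le ht
          rw [ofReal_rpow_div_ofReal p ht0, maximalRearrangement,
            show (1 / p - 2 : ℝ) = (1 / p - 1) - 1 by ring, Real.rpow_sub_one ht0.ne' (1 / p - 1),
            ENNReal.ofReal_div_of_pos ht0, mul_div_assoc', ← ENNReal.mul_div_right_comm]
          gcongr
          exact hint t
      _ = (∫⁻ t in Ioi M, ENNReal.ofReal (t ^ (1 / p - 2))) *
            (ENNReal.ofReal L * ENNReal.ofReal M) := by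
          rw [lintegral_mul_const _ (by fun_prop), setLIntegral_congr Ioi_ae_eq_Ici]
      _ < ∞ := ENNReal.mul_lt_top (integrableOn_Ioi_rpow_of_lt hp' hM0).lintegral_lt_top
          (ENNReal.mul_lt_top (by simp) (by simp))

theorem lorentzNorm_zero {p : ℝ} : lorentzNorm p 1 Ω (0 : E n → F) = 0 := by
  have h : ∀ t, rearrangement Ω (0 : E n → F) t = 0 := fun t =>
    le_antisymm (rearrangement_le_of_enorm_le (by simp) t) bot_le
  simp [lorentzNorm_one_right, maximalRearrangement, h]

end Lorentz

/-! ### Polar coordinates and the radial weight. -/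

section Polar

variable {n : ℕ}

/-- Integration in polar coordinates. -/
theorem lintegral_eq_lintegral_sphere (hn : 1 ≤ n) {h : E n → ℝ≥0∞} (hh : Measurable h) :
    ∫⁻ x, h x = ∫⁻ θ, (∫⁻ ρ in Ioi (0 : ℝ), ENNReal.ofReal (ρ ^ (n - 1)) * h (ρ • (θ : E n)))
      ∂(volume : Measure (E n)).toSphere := by
  have : Nonempty (Fin n) := ⟨⟨0, hn⟩⟩
  have hmp := (volume : Measure (E n)).measurePreserving_homeomorphUnitSphereProd
  have hemb := (homeomorphUnitSphereProd (E n)).measurableEmbedding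
  have hm : Measurable fun z : Metric.sphere (0 : E n) 1 × Ioi (0 : ℝ) =>
      h (z.2.1 • (z.1 : E n)) := by fun_prop
  calc ∫⁻ x, h x = ∫⁻ x in ({0}ᶜ : Set (E n)), h x := by rw [restrict_compl_singleton]
    _ = ∫⁻ x : ({0}ᶜ : Set (E n)), h x ∂(volume.comap Subtype.val) :=
        (lintegral_subtype_comap (measurableSet_singleton _).compl h).symm
    _ = ∫⁻ x : ({0}ᶜ : Set (E n)), (fun z : Metric.sphere (0 : E n) 1 × Ioi (0 : ℝ) =>
          h (z.2.1 • (z.1 : E n))) (homeomorphUnitSphereProd (E n) x)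
          ∂(volume.comap Subtype.val) := by
        refine lintegral_congr fun x => ?_
        have hx : ‖(x : E n)‖ ≠ 0 := norm_ne_zero_iff.2 x.2
        simp [smul_smul, hx]
    _ = ∫⁻ z, h (z.2.1 • (z.1 : E n))
          ∂((volume : Measure (E n)).toSphere.prod (Measure.volumeIoiPow (n - 1))) := by
        rw [finrank_euclideanSpace_fin] at hmp
        exact hmp.lintegral_comp_emb hemb fun z => h (z.2.1 • (z.1 : E n))
    _ = ∫⁻ θ, ∫⁻ ρ, h (ρ.1 • (θ : E n)) ∂(Measure.volumeIoiPow (n - 1))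
          ∂(volume : Measure (E n)).toSphere := lintegral_prod _ hm.aemeasurable
    _ = _ := by
        refine lintegral_congr fun θ => ?_
        rw [Measure.volumeIoiPow, lintegral_withDensity_eq_lintegral_mul _ (by fun_prop)
          (by fun_prop)]
        exact lintegral_subtype_comap measurableSet_Ioi
          fun ρ : ℝ => ENNReal.ofReal (ρ ^ (n - 1)) * h (ρ • (θ : E n))

/-- The weight `|x - c|^{1 - n}`. -/
noncomputable def radialWeight (c x : E n) : ℝ≥0∞ := (‖x - c‖ₑ ^ (n - 1))⁻¹

theorem measurable_radialWeight (c : E n) : Measurable (radialWeight c) := by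
  unfold radialWeight
  fun_prop

/-- The weight cancels the Jacobian ρ^(n-1), leaving unweighted integrals along the rays from c. -/
theorem lintegral_mul_radialWeight (hn : 1 ≤ n) (c : E n) {h : E n → ℝ≥0∞} (hh : Measurable h) :
    ∫⁻ x, h x * radialWeight c x =
      ∫⁻ θ, (∫⁻ ρ in Ioi (0 : ℝ), h (c + ρ • (θ : E n))) ∂(volume : Measure (E n)).toSphere := by
  rw [← lintegral_add_left_eq_self _ c, lintegral_eq_lintegral_sphere hn]
  · refine lintegral_congr fun θ => setLIntegral_congr_fun measurableSet_Ioi fun ρ hρ => ?_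
    have hρ' : (0 : ℝ) < ρ := hρ
    have hθ : ‖(θ : E n)‖ = 1 := by simp
    have : ‖ρ • (θ : E n)‖ₑ = ENNReal.ofReal ρ := by
      rw [← ofReal_norm, norm_smul, hθ, mul_one, Real.norm_of_nonneg hρ'.le]
    simp only [radialWeight, add_sub_cancel_left, this]
    rw [ENNReal.ofReal_pow hρ'.le, mul_left_comm, ENNReal.mul_inv_cancel, mul_one]
    · simp [hρ']
    · simp
  · exact (hh.comp (measurable_const_add c)).mul
      ((measurable_radialWeight c).comp (measurable_const_add c))

theorem ofReal_unitBallVolume :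
    ENNReal.ofReal (unitBallVolume n) = volume (Metric.ball (0 : E n) 1) := by
  rw [unitBallVolume, ofReal_measureReal measure_ball_lt_top.ne]

theorem unitBallVolume_pos : 0 < unitBallVolume n :=
  ENNReal.toReal_pos (Metric.measure_ball_pos _ _ one_pos).ne' measure_ball_lt_top.ne

theorem toSphere_univ_eq :
    (volume : Measure (E n)).toSphere univ = ENNReal.ofReal (n * unitBallVolume n) := by
  rw [Measure.toSphere_apply_univ, finrank_euclideanSpace_fin, ENNReal.ofReal_mul (by positivity),
    ofReal_unitBallVolume, ENNReal.ofReal_natCast]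

/-- The annulus `{x | r < |x - c| < R}`. -/
def annulus (c : E n) (r R : ℝ) : Set (E n) := {x | ‖x - c‖ ∈ Ioo r R}

theorem measurableSet_annulus (c : E n) (r R : ℝ) : MeasurableSet (annulus c r R) :=
  measurableSet_Ioo.preimage (by fun_prop : Measurable fun x : E n => ‖x - c‖)

theorem add_smul_mem_annulus {c : E n} {r R ρ : ℝ} (hρ : 0 < ρ) (θ : Metric.sphere (0 : E n) 1) :
    c + ρ • (θ : E n) ∈ annulus c r R ↔ ρ ∈ Ioo r R := by
  have hθ : ‖(θ : E n)‖ = 1 := by simp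
  simp only [annulus, mem_ofPred_eq, add_sub_cancel_left, norm_smul, hθ, mul_one,
    Real.norm_of_nonneg hρ.le]

theorem setLIntegral_annulus_radialWeight (hn : 1 ≤ n) (c : E n) {r R : ℝ} (hr : 0 ≤ r) :
    ∫⁻ x in annulus c r R, radialWeight c x =
      ENNReal.ofReal (n * unitBallVolume n) * ENNReal.ofReal (R - r) := by
  calc ∫⁻ x in annulus c r R, radialWeight c x
      = ∫⁻ x, (annulus c r R).indicator 1 x * radialWeight c x := by
        rw [← lintegral_indicator (measurableSet_annulus c r R)]
        refine lintegral_congr fun x => ?_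
        by_cases hx : x ∈ annulus c r R <;> simp [hx]
    _ = ∫⁻ θ, ENNReal.ofReal (R - r) ∂(volume : Measure (E n)).toSphere := by
        rw [lintegral_mul_radialWeight hn c
          (measurable_one.indicator (measurableSet_annulus c r R))]
        refine lintegral_congr fun θ => ?_
        calc _ = ∫⁻ ρ in Ioi (0 : ℝ), (Ioo r R).indicator 1 ρ := by
              refine setLIntegral_congr_fun measurableSet_Ioi fun ρ hρ => ?_
              have := add_smul_mem_annulus (c := c) (r := r) (R := R) hρ θ
              by_cases h : ρ ∈ Ioo r R <;> simp [this, h]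
          _ = volume (Ioo r R ∩ Ioi 0) := by
              rw [lintegral_indicator_one measurableSet_Ioo,
                Measure.restrict_apply measurableSet_Ioo]
          _ = _ := by
              rw [inter_eq_left.2 (Ioo_subset_Ioi_self.trans (Ioi_subset_Ioi hr)), Real.volume_Ioo]
    _ = _ := by rw [lintegral_const, toSphere_univ_eq, mul_comm]

theorem volume_annulus (hn : 1 ≤ n) (c : E n) {r R : ℝ} (hr : 0 ≤ r) (hrR : r ≤ R) :
    volume (annulus c r R) = ENNReal.ofReal (unitBallVolume n * (R ^ n - r ^ n)) := by
  have : Nonempty (Fin n) := ⟨⟨0, hn⟩⟩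
  have h : annulus c r R = Metric.ball c R \ Metric.closedBall c r := by
    ext x
    simp [annulus, dist_eq_norm, and_comm]
  rcases hrR.eq_or_lt with rfl | hlt
  · simp [annulus]
  rw [h, measure_sdiff (Metric.closedBall_subset_ball hlt)
    Metric.isClosed_closedBall.measurableSet.nullMeasurableSet measure_closedBall_lt_top.ne,
    Measure.addHaar_closedBall _ _ hr, Measure.addHaar_ball _ _ (hr.trans hrR),
    finrank_euclideanSpace_fin, ← ofReal_unitBallVolume,
    ← ENNReal.ofReal_mul (pow_nonneg (hr.trans hrR) n), ← ENNReal.ofReal_mul (pow_nonneg hr n),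
    ← ENNReal.ofReal_sub _
      (mul_nonneg (by positivity) unitBallVolume_pos.le)]
  congr 1
  ring

/-- Among the sets of given measure outside a ball, the annulus around that ball maximizes the
integral of the radial weight. -/
theorem setLIntegral_radialWeight_le (hn : 1 ≤ n) (c : E n) {r R : ℝ} (hr : 0 ≤ r) (hrR : r < R)
    {A : Set (E n)} (hA : MeasurableSet A) (hAr : ∀ x ∈ A, r < ‖x - c‖)
    (hvol : volume A = ENNReal.ofReal (unitBallVolume n * (R ^ n - r ^ n))) :
    ∫⁻ x in A, radialWeight c x ≤
      ENNReal.ofReal (n * unitBallVolume n) * ENNReal.ofReal (R - r) := by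
  set B := annulus c r R with hB
  have hBm : MeasurableSet B := measurableSet_annulus c r R
  have hvB : volume B = volume A := by rw [hvol, hB, volume_annulus hn c hr hrR.le]
  have hfin : volume A ≠ ∞ := by rw [hvol]; exact ENNReal.ofReal_ne_top
  have hR : 0 < R := hr.trans_lt hrR
  -- K is the weight on the sphere of radius R: it bounds the weight above on A \ B and below on B \
  -- A, and these two sets have equal volume.
  set K : ℝ≥0∞ := (ENNReal.ofReal R ^ (n - 1))⁻¹
  have hdiff : volume (A \ B) = volume (B \ A) := by
    have h1 := measure_inter_add_sdiff (μ := volume) A hBm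
    have h2 := measure_inter_add_sdiff (μ := volume) B hA
    rw [inter_comm, hvB, ← h1] at h2
    refine ((ENNReal.add_right_inj ?_).1 h2).symm
    exact measure_ne_top_of_subset inter_subset_left hfin
  calc ∫⁻ x in A, radialWeight c x
      = (∫⁻ x in A ∩ B, radialWeight c x) + ∫⁻ x in A \ B, radialWeight c x :=
        (lintegral_inter_add_sdiff _ _ hBm).symm
    _ ≤ (∫⁻ x in A ∩ B, radialWeight c x) + ∫⁻ x in A \ B, K := by
        refine add_le_add le_rfl ?_
        refine setLIntegral_mono' (hA.diff hBm) fun x hx => ?_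
        have : R ≤ ‖x - c‖ := by
          by_contra hlt
          exact hx.2 ⟨hAr x hx.1, not_le.1 hlt⟩
        rw [radialWeight, ← ofReal_norm]
        exact ENNReal.inv_le_inv.2 (pow_le_pow_left' (ENNReal.ofReal_le_ofReal this) _)
    _ = (∫⁻ x in B ∩ A, radialWeight c x) + ∫⁻ x in B \ A, K := by
        rw [setLIntegral_const, setLIntegral_const, hdiff, inter_comm]
    _ ≤ (∫⁻ x in B ∩ A, radialWeight c x) + ∫⁻ x in B \ A, radialWeight c x := by
        refine add_le_add le_rfl ?_
        refine setLIntegral_mono' (hBm.diff hA) fun x hx => ?_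
        have : ‖x - c‖ ≤ R := hx.1.2.le
        rw [radialWeight, ← ofReal_norm]
        exact ENNReal.inv_le_inv.2 (pow_le_pow_left' (ENNReal.ofReal_le_ofReal this) _)
    _ = ∫⁻ x in B, radialWeight c x := lintegral_inter_add_sdiff _ _ hA
    _ = _ := setLIntegral_annulus_radialWeight hn c hr

end Polar

/-! ### Weighted integrals against the Lorentz quasinorm, and estimates along rays. -/

section WeightedEstimates

variable {n : ℕ} {F : Type*} [NormedAddCommGroup F] {Ω : Set (E n)} {c : E n} {r κ : ℝ}

theorem lorentzQuasinorm_congr_ae (hΩ : MeasurableSet Ω) {f g : E n → F}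
    (h : f =ᵐ[volume.restrict Ω] g) (p q : ℝ) :
    lorentzQuasinorm p q Ω f = lorentzQuasinorm p q Ω g := by
  have hd : distribution Ω f = distribution Ω g := by
    funext t
    refine measure_congr ?_
    filter_upwards [(ae_restrict_iff' hΩ).1 h] with x hx
    refine propext ?_
    change (x ∈ Ω ∧ t < ‖f x‖ₑ) ↔ (x ∈ Ω ∧ t < ‖g x‖ₑ)
    exact and_congr_right fun hxΩ => by rw [hx hxΩ]
  unfold lorentzQuasinorm rearrangement
  rw [hd]

/-- The integral of the radial weight over a set outside `closedBall c r` in terms of the measure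
of the set. -/
theorem setLIntegral_radialWeight_le_rpow (hn : 1 ≤ n) (hr : 0 ≤ r) (hκ0 : 0 ≤ κ)
    {A : Set (E n)} (hA : MeasurableSet A) (hAr : ∀ x ∈ A, r < ‖x - c‖) (hfin : volume A ≠ ∞)
    (hκ : ∀ R, r < R → ENNReal.ofReal (unitBallVolume n * (R ^ n - r ^ n)) ≤ volume A →
      (R - r) ^ n ≤ κ * (R ^ n - r ^ n)) :
    ∫⁻ x in A, radialWeight c x ≤
      ENNReal.ofReal (unitBallVolume n ^ (1 - 1 / (n : ℝ)) * κ ^ (1 / (n : ℝ))) *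
        (ENNReal.ofReal n * volume A ^ (1 / (n : ℝ))) := by
  have hn0 : n ≠ 0 := by omega
  have hω := unitBallVolume_pos (n := n)
  set ω := unitBallVolume n
  set m := (volume A).toReal with hm
  have hAm : volume A = ENNReal.ofReal m := (ENNReal.ofReal_toReal hfin).symm
  have hm0 : 0 ≤ m := ENNReal.toReal_nonneg
  rcases hm0.eq_or_lt with h0 | hmpos
  · have : volume A = 0 := by rw [hAm, ← h0, ENNReal.ofReal_zero]
    rw [setLIntegral_measure_zero _ _ this]
    exact zero_le
  have hpow : 0 < r ^ n + m / ω := by positivity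
  -- This outer radius gives the annulus the same volume as A, so `hκ` is needed only for radii
  -- whose annulus fits into A by volume.
  set R := (r ^ n + m / ω) ^ (1 / (n : ℝ)) with hR
  have hRn : R ^ n = r ^ n + m / ω := by
    rw [hR, one_div, Real.rpow_inv_natCast_pow hpow.le hn0]
  have hrR : r < R := by
    refine lt_of_pow_lt_pow_left₀ n (Real.rpow_nonneg hpow.le _) ?_
    rw [hRn]
    have : 0 < m / ω := by positivity
    linarith
  have hvol : volume A = ENNReal.ofReal (ω * (R ^ n - r ^ n)) := by
    rw [hRn, hAm]
    congr 1
    field_simp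
    ring
  refine (setLIntegral_radialWeight_le hn c hr hrR hA hAr hvol).trans ?_
  have hle := hκ R hrR hvol.ge
  rw [hRn, add_sub_cancel_left] at hle
  have hle' : R - r ≤ κ ^ (1 / (n : ℝ)) * (m ^ (1 / (n : ℝ)) / ω ^ (1 / (n : ℝ))) := by
    rw [← Real.div_rpow hmpos.le hω.le, ← Real.mul_rpow hκ0 (by positivity)]
    rw [one_div, Real.le_rpow_inv_iff_of_pos (by linarith) (by positivity) (by positivity),
      Real.rpow_natCast]
    exact hle
  rw [hAm, ENNReal.ofReal_rpow_of_pos hmpos, ← ENNReal.ofReal_mul (by positivity),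
    ← ENNReal.ofReal_mul (by positivity), ← ENNReal.ofReal_mul (by positivity)]
  refine ENNReal.ofReal_le_ofReal ?_
  calc n * ω * (R - r)
      ≤ n * ω * (κ ^ (1 / (n : ℝ)) * (m ^ (1 / (n : ℝ)) / ω ^ (1 / (n : ℝ)))) := by gcongr
    _ = _ := by
        rw [Real.rpow_sub hω, Real.rpow_one]
        field_simp

/-- The Hardy-Littlewood type estimate of a weighted integral by the `n, 1` quasinorm. -/
theorem setLIntegral_enorm_mul_radialWeight_le (hn : 1 ≤ n) (hr : 0 ≤ r) (hκ0 : 0 ≤ κ)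
    (hΩ : MeasurableSet Ω) (hfin : volume Ω ≠ ∞)
    (hκ : ∀ R, r < R →
      ENNReal.ofReal (unitBallVolume n * (R ^ n - r ^ n)) ≤ volume (Ω \ Metric.closedBall c r) →
      (R - r) ^ n ≤ κ * (R ^ n - r ^ n))
    {f : E n → F} (hf : AEStronglyMeasurable f (volume.restrict Ω)) :
    ∫⁻ x in Ω \ Metric.closedBall c r, ‖f x‖ₑ * radialWeight c x ≤
      ENNReal.ofReal (unitBallVolume n ^ (1 - 1 / (n : ℝ)) * κ ^ (1 / (n : ℝ))) *
        lorentzQuasinorm n 1 Ω f := by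
  set A := Ω \ Metric.closedBall c r with hA
  have hAm : MeasurableSet A := hΩ.diff Metric.isClosed_closedBall.measurableSet
  set C := ENNReal.ofReal (unitBallVolume n ^ (1 - 1 / (n : ℝ)) * κ ^ (1 / (n : ℝ)))
  obtain ⟨g, hg, hfg⟩ := hf
  rw [lorentzQuasinorm_congr_ae hΩ hfg]
  have hfgA : f =ᵐ[volume.restrict A] g := ae_restrict_of_ae_restrict_of_subset sdiff_subset hfg
  have hgn : Measurable fun x => ‖g x‖ := hg.norm.measurable
  calc ∫⁻ x in A, ‖f x‖ₑ * radialWeight c x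
      = ∫⁻ x in A, ‖g x‖ₑ * radialWeight c x := by
        refine lintegral_congr_ae ?_
        filter_upwards [hfgA] with x hx
        rw [hx]
    -- Absorbing the weight into the measure makes the layer cake formula produce weighted measures
    -- of superlevel sets.
    _ = ∫⁻ x, ENNReal.ofReal ‖g x‖ ∂((volume.restrict A).withDensity (radialWeight c)) := by
        rw [lintegral_withDensity_eq_lintegral_mul _ (measurable_radialWeight c) (by fun_prop)]
        refine lintegral_congr fun x => ?_
        rw [Pi.mul_apply, ofReal_norm, mul_comm]
    _ = ∫⁻ s in Ioi (0 : ℝ), ((volume.restrict A).withDensity (radialWeight c)) {x | s < ‖g x‖} :=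
        lintegral_eq_lintegral_meas_lt _ (Eventually.of_forall fun _ => norm_nonneg _)
          hgn.aemeasurable
    _ ≤ ∫⁻ s in Ioi (0 : ℝ),
          C * (ENNReal.ofReal n * distribution Ω g (ENNReal.ofReal s) ^ (1 / (n : ℝ))) := by
        refine setLIntegral_mono' measurableSet_Ioi fun s hs => ?_
        have hS : MeasurableSet {x | s < ‖g x‖} := measurableSet_lt measurable_const hgn
        rw [withDensity_apply _ hS, Measure.restrict_restrict hS]
        have hsub : {x | s < ‖g x‖} ∩ A ⊆ A := inter_subset_right
        refine (setLIntegral_radialWeight_le_rpow hn hr hκ0 (hS.inter hAm) ?_ ?_ ?_).trans ?_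
        · intro x hx
          simpa [dist_eq_norm] using hx.2.2
        · exact measure_ne_top_of_subset (hsub.trans sdiff_subset) hfin
        · exact fun R hR h => hκ R hR (h.trans (measure_mono hsub))
        · gcongr
          refine measure_mono fun x hx => ⟨hx.2.1, ?_⟩
          rw [← ofReal_norm]
          exact (ENNReal.ofReal_lt_ofReal_iff_of_nonneg (le_of_lt hs)).2 hx.1
    _ = C * ∫⁻ s in Ioi (0 : ℝ),
          ENNReal.ofReal n * distribution Ω g (ENNReal.ofReal s) ^ (1 / (n : ℝ)) :=
        lintegral_const_mul' _ _ ENNReal.ofReal_ne_top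
    _ ≤ C * lorentzQuasinorm n 1 Ω g := by
        gcongr
        exact lintegral_distribution_rpow_le (by positivity) hfin

theorem norm_gradient {φ : E n → ℝ} (x : E n) : ‖gradient φ x‖ = ‖fderiv ℝ φ x‖ := by
  rw [gradient, LinearIsometryEquiv.norm_map]

theorem continuous_gradient {φ : E n → ℝ} (hφ : ContDiff ℝ 1 φ) : Continuous (gradient φ) :=
  (InnerProductSpace.toDual ℝ (E n)).symm.continuous.comp (hφ.continuous_fderiv (by simp))

/-- The fundamental theorem of calculus on the ray, up to a point beyond the support. -/
theorem enorm_le_lintegral_gradient_ray {φ : E n → ℝ} (hφ : ContDiff ℝ 1 φ)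
    (hsupp : HasCompactSupport φ) (c : E n) (θ : Metric.sphere (0 : E n) 1) (ρ : ℝ) :
    ‖φ (c + ρ • (θ : E n))‖ₑ ≤ ∫⁻ s in Ioi ρ, ‖gradient φ (c + s • (θ : E n))‖ₑ := by
  have hθ : ‖(θ : E n)‖ = 1 := by simp
  obtain ⟨M, hM⟩ := hsupp.isCompact.isBounded.subset_closedBall c
  obtain ⟨b, hb⟩ := exists_gt (max (max ρ M) 0)
  have hbρ : ρ < b := ((le_max_left _ _).trans (le_max_left _ _)).trans_lt hb
  have hbM : M < b := ((le_max_right _ _).trans (le_max_left _ _)).trans_lt hb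
  have hb0 : 0 < b := (le_max_right _ _).trans_lt hb
  have hzero : φ (c + b • (θ : E n)) = 0 := by
    refine image_eq_zero_of_notMem_tsupport fun hmem => ?_
    have := hM hmem
    rw [mem_closedBall_iff_norm, add_sub_cancel_left, norm_smul, hθ, mul_one,
      Real.norm_of_nonneg hb0.le] at this
    exact this.not_gt hbM
  have hline : ∀ s : ℝ, HasDerivAt (fun s : ℝ => c + s • (θ : E n)) (θ : E n) s := fun s => by
    simpa using ((hasDerivAt_id s).smul_const (θ : E n)).const_add c
  have hderiv : ∀ s : ℝ, deriv (fun s : ℝ => φ (c + s • (θ : E n))) s =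
      fderiv ℝ φ (c + s • (θ : E n)) θ := fun s =>
    ((hφ.differentiable (by simp) _).hasFDerivAt.comp_hasDerivAt s (hline s)).deriv
  have hcd : ContDiff ℝ 1 fun s : ℝ => φ (c + s • (θ : E n)) := hφ.comp (by fun_prop)
  calc ‖φ (c + ρ • (θ : E n))‖ₑ = ‖φ (c + b • (θ : E n)) - φ (c + ρ • (θ : E n))‖ₑ := by
        rw [hzero, zero_sub, enorm_neg]
    _ ≤ ∫⁻ s in Icc ρ b, ‖deriv (fun s : ℝ => φ (c + s • (θ : E n))) s‖ₑ :=
        enorm_sub_le_lintegral_deriv_of_contDiffOn_Icc hcd.contDiffOn hbρ.le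
    _ ≤ ∫⁻ s in Icc ρ b, ‖gradient φ (c + s • (θ : E n))‖ₑ := by
        refine lintegral_mono fun s => ?_
        rw [hderiv, enorm_le_iff_norm_le, norm_gradient]
        simpa [hθ] using (fderiv ℝ φ (c + s • (θ : E n))).le_opNorm (θ : E n)
    _ ≤ ∫⁻ s in Ici ρ, ‖gradient φ (c + s • (θ : E n))‖ₑ :=
        lintegral_mono_set Icc_subset_Ici_self
    _ = _ := setLIntegral_congr Ioi_ae_eq_Ici.symm

/-- A radial Poincaré inequality outside a ball. -/
theorem setLIntegral_annulus_enorm_le (hn : 1 ≤ n) {φ : E n → ℝ} (hφ : ContDiff ℝ 1 φ)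
    (hsupp : HasCompactSupport φ) (c : E n) (hr : 0 ≤ r) (δ : ℝ) :
    ∫⁻ x in annulus c r (r + δ), ‖φ x‖ₑ * radialWeight c x ≤
      ENNReal.ofReal δ *
        ∫⁻ x in (Metric.closedBall c r)ᶜ, ‖gradient φ x‖ₑ * radialWeight c x := by
  have hBm := measurableSet_annulus c r (r + δ)
  have hcm : MeasurableSet (Metric.closedBall c r)ᶜ := Metric.isClosed_closedBall.measurableSet.compl
  have hgm : Measurable fun x => ‖gradient φ x‖ₑ := (continuous_gradient hφ).measurable.enorm
  have hφm : Measurable fun x => ‖φ x‖ₑ := hφ.continuous.measurable.enorm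
  have hind : ∀ (S : Set (E n)) (h : E n → ℝ≥0∞), MeasurableSet S →
      ∫⁻ x in S, h x * radialWeight c x = ∫⁻ x, S.indicator h x * radialWeight c x := by
    intro S h hS
    rw [← lintegral_indicator hS]
    refine lintegral_congr fun x => ?_
    by_cases hx : x ∈ S <;> simp [hx]
  rw [hind _ _ hBm, hind _ _ hcm, lintegral_mul_radialWeight hn c (hφm.indicator hBm),
    lintegral_mul_radialWeight hn c (hgm.indicator hcm),
    ← lintegral_const_mul' _ _ ENNReal.ofReal_ne_top]
  refine lintegral_mono fun θ => ?_
  have hθ : ‖(θ : E n)‖ = 1 := by simp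
  have hray : ∫⁻ ρ in Ioi (0 : ℝ), (Metric.closedBall c r)ᶜ.indicator
      (fun x => ‖gradient φ x‖ₑ) (c + ρ • (θ : E n)) =
      ∫⁻ ρ in Ioi r, ‖gradient φ (c + ρ • (θ : E n))‖ₑ := by
    rw [← lintegral_indicator measurableSet_Ioi, ← lintegral_indicator measurableSet_Ioi]
    refine lintegral_congr fun ρ => ?_
    by_cases hρ : 0 < ρ
    · have : c + ρ • (θ : E n) ∈ (Metric.closedBall c r)ᶜ ↔ r < ρ := by
        simp [norm_smul, hθ, abs_of_pos hρ]
      by_cases hrρ : r < ρ <;> simp only [indicator, this, hρ, hrρ, mem_Ioi, if_true, if_false]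
    · have : ¬ r < ρ := fun h => hρ (hr.trans_lt h)
      simp [hρ, this]
  rw [hray]
  -- One bound G serves every radius in (r, r + δ), so integrating over this interval costs only a
  -- factor δ.
  set G := ∫⁻ ρ in Ioi r, ‖gradient φ (c + ρ • (θ : E n))‖ₑ
  calc ∫⁻ ρ in Ioi (0 : ℝ), (annulus c r (r + δ)).indicator (fun x => ‖φ x‖ₑ) (c + ρ • (θ : E n))
      ≤ ∫⁻ ρ in Ioi (0 : ℝ), (Ioo r (r + δ)).indicator (fun _ => G) ρ := by
        refine setLIntegral_mono' measurableSet_Ioi fun ρ hρ => ?_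
        have := add_smul_mem_annulus (c := c) (r := r) (R := r + δ) hρ θ
        by_cases h : ρ ∈ Ioo r (r + δ)
        · simp only [indicator, this, h, if_true]
          exact (enorm_le_lintegral_gradient_ray hφ hsupp c θ ρ).trans
            (lintegral_mono_set (Ioi_subset_Ioi h.1.le))
        · simp only [indicator, this, h, if_false, le_refl]
    _ ≤ ∫⁻ ρ, (Ioo r (r + δ)).indicator (fun _ => G) ρ := setLIntegral_le_lintegral _ _
    _ = ENNReal.ofReal δ * G := by
        rw [lintegral_indicator_const measurableSet_Ioo, Real.volume_Ioo, add_sub_cancel_left,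
          mul_comm]

end WeightedEstimates

/-! ### The lower bound for the capacity. -/

section CapacityLowerBound

variable {n : ℕ} {Ω : Set (E n)} {c : E n} {r κ : ℝ}

theorem lorentzQuasinorm_le_sobolevLorentzNorm (hn : 1 ≤ n) (u : E n → ℝ) (v : E n → E n) :
    lorentzQuasinorm n 1 Ω u ≤ sobolevLorentzNorm n 1 Ω u v ∧
      lorentzQuasinorm n 1 Ω v ≤ sobolevLorentzNorm n 1 Ω u v := by
  have hmin : min (n : ℝ) 1 = 1 := min_eq_right (by exact_mod_cast hn)
  simp only [sobolevLorentzNorm, hmin, ENNReal.rpow_one, div_one]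
  exact ⟨(lorentzQuasinorm_le_lorentzNorm _).trans le_self_add,
    (lorentzQuasinorm_le_lorentzNorm _).trans le_add_self⟩

theorem setLIntegral_gradient_mul_le {φ : E n → ℝ} (hφ : tsupport φ ⊆ Ω) (hΩ : MeasurableSet Ω)
    {S : Set (E n)} (hS : MeasurableSet S) (w : E n → ℝ≥0∞) :
    ∫⁻ x in Sᶜ, ‖gradient φ x‖ₑ * w x ≤ ∫⁻ x in Ω \ S, ‖gradient φ x‖ₑ * w x := by
  have hzero : ∀ x ∉ Ω, gradient φ x = 0 := fun x hx => by
    rw [gradient, fderiv_of_notMem_tsupport ℝ fun h => hx (hφ h), map_zero]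
  rw [← lintegral_inter_add_sdiff _ Sᶜ hΩ, setLIntegral_congr_fun (g := 0) (hS.compl.diff hΩ)
    fun x hx => by simp [hzero x hx.2]]
  rw [inter_comm, ← sdiff_eq]
  simp

/-- Ray estimates apply to the smooth approximants, which need not be at least 1 near the ball.
Averaging over a thin annulus where u ≥ 1 replaces pointwise values by weighted integrals, which
pass to the limit because the weighted estimate controls them by the Sobolev-Lorentz norm. -/
theorem le_setLIntegral_of_isAdmissible (hn : 1 ≤ n) (hr : 0 ≤ r) (hκ0 : 0 ≤ κ)
    (hΩ : IsOpen Ω) (hfin : volume Ω ≠ ∞)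
    (hκ : ∀ R, r < R →
      ENNReal.ofReal (unitBallVolume n * (R ^ n - r ^ n)) ≤ volume (Ω \ Metric.closedBall c r) →
      (R - r) ^ n ≤ κ * (R ^ n - r ^ n))
    {u : E n → ℝ} {v : E n → E n} (h : IsAdmissible n 1 (Metric.closedBall c r) Ω u v) :
    ENNReal.ofReal (n * unitBallVolume n) ≤
      ∫⁻ x in Ω \ Metric.closedBall c r, ‖v x‖ₑ * radialWeight c x := by
  obtain ⟨⟨⟨hu, hv, -⟩, -, -, φ, hφ, hlim⟩, U, hU, hcU, hUΩ, hu1⟩ := h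
  have hum := hu.aestronglyMeasurable
  have hvm := hv.aestronglyMeasurable
  obtain ⟨δ, hδ, hδU⟩ := (isCompact_closedBall c r).exists_thickening_subset_open hU hcU
  rw [thickening_closedBall hδ hr] at hδU
  set w := radialWeight c
  have hwm : Measurable w := measurable_radialWeight c
  set A := Ω \ Metric.closedBall c r with hA
  have hAm : MeasurableSet A := hΩ.measurableSet.diff Metric.isClosed_closedBall.measurableSet
  set B := annulus c r (r + δ) with hB
  have hBm : MeasurableSet B := measurableSet_annulus _ _ _
  have hBU : B ⊆ U := fun x hx => hδU (by
    rw [mem_ball_iff_norm, add_comm]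
    exact hx.2)
  have hBA : B ⊆ A := fun x hx => ⟨hUΩ (hBU hx), by
    rw [mem_closedBall_iff_norm, not_le]
    exact hx.1⟩
  set C := ENNReal.ofReal (unitBallVolume n ^ (1 - 1 / (n : ℝ)) * κ ^ (1 / (n : ℝ))) with hC
  set S := fun k => sobolevLorentzNorm n 1 Ω (φ k - u) (gradient (φ k) - v) with hS
  have hBC : ∀ k, ∫⁻ x in B, ‖(φ k - u) x‖ₑ * w x ≤ C * S k := fun k =>
    calc ∫⁻ x in B, ‖(φ k - u) x‖ₑ * w x ≤ ∫⁻ x in A, ‖(φ k - u) x‖ₑ * w x := lintegral_mono_set hBA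
      _ ≤ C * lorentzQuasinorm n 1 Ω (φ k - u) :=
          setLIntegral_enorm_mul_radialWeight_le hn hr hκ0 hΩ.measurableSet hfin hκ
            ((hφ k).1.continuous.aestronglyMeasurable.sub hum)
      _ ≤ C * S k := by
          gcongr
          exact (lorentzQuasinorm_le_sobolevLorentzNorm hn _ _).1
  have hcont : ∀ k, Continuous (gradient (φ k)) := fun k =>
    continuous_gradient ((hφ k).1.of_le (by exact_mod_cast le_top))
  have hAC : ∀ k, ∫⁻ x in A, ‖(gradient (φ k) - v) x‖ₑ * w x ≤ C * S k := fun k =>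
    calc ∫⁻ x in A, ‖(gradient (φ k) - v) x‖ₑ * w x
        ≤ C * lorentzQuasinorm n 1 Ω (gradient (φ k) - v) :=
          setLIntegral_enorm_mul_radialWeight_le hn hr hκ0 hΩ.measurableSet hfin hκ
            ((hcont k).aestronglyMeasurable.sub hvm)
      _ ≤ C * S k := by
          gcongr
          exact (lorentzQuasinorm_le_sobolevLorentzNorm hn _ _).2
  set I := ∫⁻ x in A, ‖v x‖ₑ * w x with hI
  have key : ∀ k, ENNReal.ofReal (n * unitBallVolume n) * ENNReal.ofReal δ ≤
      ENNReal.ofReal δ * (I + C * S k) + C * S k := by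
    intro k
    calc ENNReal.ofReal (n * unitBallVolume n) * ENNReal.ofReal δ = ∫⁻ x in B, w x := by
          rw [hB, setLIntegral_annulus_radialWeight hn c hr, add_sub_cancel_left]
      _ ≤ ∫⁻ x in B, (‖φ k x‖ₑ * w x + ‖(φ k - u) x‖ₑ * w x) := by
          refine setLIntegral_mono_ae' hBm ?_
          filter_upwards [hu1] with x hx hxB
          rw [← add_mul]
          refine le_mul_of_one_le_left zero_le ?_
          have h1 : (1 : ℝ≥0∞) ≤ ‖u x‖ₑ := by
            rw [← ofReal_norm, ENNReal.one_le_ofReal]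
            exact (hx (hBU hxB)).trans (le_abs_self _)
          refine h1.trans ?_
          simpa using enorm_sub_le (a := φ k x) (b := (φ k - u) x)
      _ = (∫⁻ x in B, ‖φ k x‖ₑ * w x) + ∫⁻ x in B, ‖(φ k - u) x‖ₑ * w x :=
          lintegral_add_left ((hφ k).1.continuous.measurable.enorm.mul hwm) _
      _ ≤ ENNReal.ofReal δ * (I + C * S k) + C * S k := by
          refine add_le_add ?_ (hBC k)
          refine (setLIntegral_annulus_enorm_le hn ((hφ k).1.of_le (by exact_mod_cast le_top))
            (hφ k).2.1 c hr δ).trans ?_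
          gcongr
          calc ∫⁻ x in (Metric.closedBall c r)ᶜ, ‖gradient (φ k) x‖ₑ * w x
              ≤ ∫⁻ x in A, ‖gradient (φ k) x‖ₑ * w x :=
                setLIntegral_gradient_mul_le (hφ k).2.2 hΩ.measurableSet
                  Metric.isClosed_closedBall.measurableSet _
            _ ≤ ∫⁻ x in A, (‖v x‖ₑ * w x + ‖(gradient (φ k) - v) x‖ₑ * w x) := by
                refine lintegral_mono fun x => ?_
                rw [← add_mul]
                gcongr
                simpa using enorm_add_le (v x) ((gradient (φ k) - v) x)
            _ = I + ∫⁻ x in A, ‖(gradient (φ k) - v) x‖ₑ * w x := by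
                refine lintegral_add_left' ?_ _
                exact ((hvm.mono_set sdiff_subset).enorm).mul hwm.aemeasurable
            _ ≤ I + C * S k := by
                gcongr
                exact hAC k
  have hCS : Tendsto (fun k => C * S k) atTop (𝓝 0) := by
    simpa using ENNReal.Tendsto.const_mul hlim (Or.inr ENNReal.ofReal_ne_top)
  have hlim' : Tendsto (fun k => ENNReal.ofReal δ * (I + C * S k) + C * S k) atTop
      (𝓝 (ENNReal.ofReal δ * (I + 0) + 0)) :=
    (ENNReal.Tendsto.const_mul (tendsto_const_nhds.add hCS) (Or.inr ENNReal.ofReal_ne_top)).add hCS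
  have hle := ge_of_tendsto' hlim' key
  rw [add_zero, add_zero, mul_comm] at hle
  -- Both sides carry the factor δ, so the width of the annulus drops out without a limit δ → 0.
  exact (ENNReal.mul_le_mul_iff_right (by simpa using hδ) ENNReal.ofReal_ne_top).1 hle

theorem le_relCapacity_closedBall (hn : 1 ≤ n) (hr : 0 ≤ r) (hκ0 : 0 < κ)
    (hΩ : IsOpen Ω) (hfin : volume Ω ≠ ∞)
    (hκ : ∀ R, r < R →
      ENNReal.ofReal (unitBallVolume n * (R ^ n - r ^ n)) ≤ volume (Ω \ Metric.closedBall c r) →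
      (R - r) ^ n ≤ κ * (R ^ n - r ^ n)) :
    ENNReal.ofReal ((n : ℝ) ^ n * unitBallVolume n / κ) ≤
      relCapacity n 1 (Metric.closedBall c r) Ω := by
  have hn0 : (n : ℝ) ≠ 0 := by
    have : n ≠ 0 := by omega
    exact_mod_cast this
  refine le_sInf ?_
  rintro _ ⟨u, v, h, rfl⟩
  have hω := unitBallVolume_pos (n := n)
  have hvm := h.1.1.2.1.aestronglyMeasurable
  have hle := (le_setLIntegral_of_isAdmissible hn hr hκ0.le hΩ hfin hκ h).trans
    (setLIntegral_enorm_mul_radialWeight_le hn hr hκ0.le hΩ.measurableSet hfin hκ hvm)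
  set ω := unitBallVolume n
  set C := ω ^ (1 - 1 / (n : ℝ)) * κ ^ (1 / (n : ℝ)) with hC
  have hC0 : 0 < C := by positivity
  -- Hence (nω / C)^n = n^n ω / κ, the claimed constant.
  have hCn : C ^ n = ω ^ n / ω * κ := by
    rw [hC, mul_pow, ← Real.rpow_natCast, ← Real.rpow_mul hω.le, ← Real.rpow_natCast (κ ^ _),
      ← Real.rpow_mul hκ0.le, sub_mul, one_mul, one_div_mul_cancel hn0, Real.rpow_one,
      Real.rpow_sub_one hω.ne', Real.rpow_natCast]
  have hle' : ENNReal.ofReal (n * ω / C) ≤ lorentzQuasinorm n 1 Ω v := by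
    rw [ENNReal.ofReal_div_of_pos hC0]
    exact ENNReal.div_le_of_le_mul' hle
  calc ENNReal.ofReal ((n : ℝ) ^ n * ω / κ) = ENNReal.ofReal (n * ω / C) ^ (n : ℝ) := by
        rw [ENNReal.rpow_natCast, ← ENNReal.ofReal_pow (by positivity), div_pow, hCn, mul_pow]
        congr 1
        field_simp
    _ ≤ _ := by gcongr

end CapacityLowerBound

/-! ### Radial cutoffs and the upper bound. -/

section UpperBound

/-- A smooth transition from `1` to `0` on `(r, ρ)` with Lipschitz constant close to
`1 / (ρ - r)`. -/
theorem exists_smooth_profile {r ρ L : ℝ} (hL0 : 0 < L) (hL : 1 / L < ρ - r) :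
    ∃ (ψ : ℝ → ℝ) (a b : ℝ), ContDiff ℝ ((⊤ : ℕ∞) : WithTop ℕ∞) ψ ∧ r < a ∧ a < b ∧ b < ρ ∧
      (∀ t ≤ a, ψ t = 1) ∧ (∀ t, b ≤ t → ψ t = 0) ∧ LipschitzWith L.toNNReal ψ := by
  have hL1 : 0 < 1 / L := by positivity
  -- The derivative of the profile is minus this bump, normalized to integral 1. The inner ball has
  -- length 1/L, which caps the height at L; `rOut` is midway between `rIn` and (ρ - r)/2, so the
  -- support stays strictly inside (r, ρ).
  let f : ContDiffBump ((r + ρ) / 2) :=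
    { rIn := 1 / L / 2
      rOut := (1 / L + (ρ - r)) / 4
      rIn_pos := by positivity
      rIn_lt_rOut := by linarith }
  set g : ℝ → ℝ := f.normed volume with hg
  have hgc : Continuous g := f.continuous_normed
  have hgs : ContDiff ℝ ((⊤ : ℕ∞) : WithTop ℕ∞) g := f.contDiff_normed
  have hgL : ∀ x, g x ≤ L := fun x => by
    refine (f.normed_le_div_measure_closedBall_rIn volume x).trans ?_
    have : volume.real (Metric.closedBall ((r + ρ) / 2) f.rIn) = 1 / L := by
      rw [Real.volume_real_closedBall f.rIn_pos.le]
      change 2 * (1 / L / 2) = 1 / L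
      ring
    rw [this, one_div_one_div]
  have hg0 : ∀ x, 0 ≤ g x := fun x => f.nonneg_normed x
  have hout : f.rOut = (1 / L + (ρ - r)) / 4 := rfl
  have hsupp : Function.support g = Ioo ((r + ρ) / 2 - f.rOut) ((r + ρ) / 2 + f.rOut) := by
    rw [hg, f.support_normed_eq, Real.ball_eq_Ioo]
  set a := (r + ρ) / 2 - f.rOut with ha
  set b := (r + ρ) / 2 + f.rOut with hb
  have hderiv : ∀ t, HasDerivAt (fun t => 1 - ∫ s in a..t, g s) (-g t) t := fun t =>
    (intervalIntegral.integral_hasDerivAt_right (hgc.intervalIntegrable _ _)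
      (hgc.stronglyMeasurableAtFilter _ _) hgc.continuousAt).const_sub 1
  have hderiv' : deriv (fun t => 1 - ∫ s in a..t, g s) = fun t => -g t :=
    funext fun t => (hderiv t).deriv
  refine ⟨fun t => 1 - ∫ s in a..t, g s, a, b, ?_, by linarith, by linarith [f.rOut_pos],
    by linarith, ?_, ?_, ?_⟩
  · refine contDiff_infty_iff_deriv.2 ⟨fun t => (hderiv t).differentiableAt, ?_⟩
    rw [hderiv']
    exact hgs.neg
  · intro t ht
    have : ∫ s in a..t, g s = 0 := by
      refine (intervalIntegral.integral_congr (g := fun _ => (0 : ℝ)) fun s hs => ?_).trans (by simp)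
      rw [uIcc_of_ge ht] at hs
      by_contra hne
      have : s ∈ Function.support g := hne
      rw [hsupp] at this
      exact this.1.not_ge hs.2
    simp [this]
  · intro t ht
    have : ∫ s in a..t, g s = 1 := by
      rw [intervalIntegral.integral_eq_integral_of_support_subset]
      · exact f.integral_normed
      · rw [hsupp]
        exact fun s hs => ⟨hs.1, hs.2.le.trans ht⟩
    simp [this]
  · refine lipschitzWith_of_nnnorm_deriv_le (fun t => (hderiv t).differentiableAt) fun t => ?_
    rw [hderiv', ← NNReal.coe_le_coe, coe_nnnorm, norm_neg, Real.norm_of_nonneg (hg0 t),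
      Real.coe_toNNReal _ hL0.le]
    exact hgL t

variable {n : ℕ} {Ω : Set (E n)} {c : E n} {r ρ : ℝ}

theorem gradient_apply (φ : E n → ℝ) (x : E n) (i : Fin n) :
    gradient φ x i = fderiv ℝ φ x (EuclideanSpace.single i 1) := by
  have h := InnerProductSpace.toDual_symm_apply (𝕜 := ℝ) (x := EuclideanSpace.single i (1 : ℝ))
    (y := fderiv ℝ φ x)
  rw [← h, EuclideanSpace.inner_single_right]
  simp [gradient]

theorem IsTestFunction.isWeakGradient {u : E n → ℝ} (hu : IsTestFunction Ω u) :
    IsWeakGradient Ω u (gradient u) := by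
  have hu1 : ContDiff ℝ 1 u := hu.1.of_le (by exact_mod_cast le_top)
  refine ⟨hu1.continuous.locallyIntegrable.locallyIntegrableOn _,
    (continuous_gradient hu1).locallyIntegrable.locallyIntegrableOn _, fun φ hφ i => ?_⟩
  have hφ1 : ContDiff ℝ 1 φ := hφ.1.of_le (by exact_mod_cast le_top)
  have hφΩ : ∀ x ∉ Ω, x ∉ tsupport φ := fun x hx h => hx (hφ.2.2 h)
  have hcφ : Continuous fun x => fderiv ℝ φ x (EuclideanSpace.single i 1) :=
    (hφ1.continuous_fderiv (by simp)).clm_apply continuous_const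
  have hcu : Continuous fun x => fderiv ℝ u x (EuclideanSpace.single i 1) :=
    (hu1.continuous_fderiv (by simp)).clm_apply continuous_const
  simp only [gradient_apply]
  rw [setIntegral_eq_integral_of_forall_compl_eq_zero fun x hx => by
      rw [image_eq_zero_of_notMem_tsupport (hφΩ x hx), zero_mul],
    setIntegral_eq_integral_of_forall_compl_eq_zero fun x hx => by
      rw [fderiv_of_notMem_tsupport ℝ (hφΩ x hx), zero_apply, zero_mul]]
  -- Since φ vanishes off Ω, the integrals now run over the whole space and there is no boundary
  -- term.
  refine integral_mul_fderiv_eq_neg_fderiv_mul_of_integrable ?_ ?_ ?_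
    (fun x _ => hφ1.differentiable (by simp) x) (fun x _ => hu1.differentiable (by simp) x)
  · exact (hcφ.mul hu1.continuous).integrable_of_hasCompactSupport hu.2.1.mul_left
  · exact (hφ1.continuous.mul hcu).integrable_of_hasCompactSupport hφ.2.1.mul_right
  · exact (hφ1.continuous.mul hu1.continuous).integrable_of_hasCompactSupport hu.2.1.mul_left

theorem lorentzNorm_lt_top_of_hasCompactSupport {F : Type*} [NormedAddCommGroup F] {p : ℝ}
    (hp : 1 < p) {f : E n → F} (hf : Continuous f) (hsupp : HasCompactSupport f)
    (hΩ : volume Ω ≠ ∞) : lorentzNorm p 1 Ω f < ∞ := by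
  obtain ⟨L, hL⟩ := hsupp.exists_bound_of_continuous hf
  refine lorentzNorm_lt_top_of_enorm_le hp (L := L) (fun x _ => ?_) hΩ
  rw [← ofReal_norm]
  exact ENNReal.ofReal_le_ofReal (hL x)

/-- The constant sequence u approximates itself; n ≥ 2 enters through finiteness of the Lorentz
norms. -/
theorem IsTestFunction.memH01 (hn : 2 ≤ n) (hΩ : volume Ω ≠ ∞) {u : E n → ℝ}
    (hu : IsTestFunction Ω u) : MemH01 n 1 Ω u (gradient u) := by
  have hu1 : ContDiff ℝ 1 u := hu.1.of_le (by exact_mod_cast le_top)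
  have hn1 : (1 : ℝ) < n := by exact_mod_cast hn
  have hsupp : HasCompactSupport (gradient u) :=
    (hu.2.1.fderiv (𝕜 := ℝ)).comp_left (g := (InnerProductSpace.toDual ℝ (E n)).symm) (map_zero _)
  refine ⟨hu.isWeakGradient, lorentzNorm_lt_top_of_hasCompactSupport hn1 hu1.continuous hu.2.1 hΩ,
    lorentzNorm_lt_top_of_hasCompactSupport hn1 (continuous_gradient hu1) hsupp hΩ,
    fun _ => u, fun _ => hu, ?_⟩
  have hmin : min (n : ℝ) 1 = 1 := min_eq_right hn1.le
  simp [sobolevLorentzNorm, hmin, lorentzNorm_zero]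

theorem relCapacity_closedBall_le_of_lipschitz (hn : 2 ≤ n) (hΩ : volume Ω ≠ ∞) (hr : 0 ≤ r)
    (hρΩ : Metric.ball c ρ ⊆ Ω) {L : ℝ} (hL0 : 0 < L) (hL : 1 / L < ρ - r) :
    relCapacity n 1 (Metric.closedBall c r) Ω ≤
      ENNReal.ofReal ((n : ℝ) ^ n * unitBallVolume n * ((ρ ^ n - r ^ n) * L ^ n)) := by
  obtain ⟨ψ, a, b, hψ, hra, hab, hbρ, hψ1, hψ0, hψL⟩ := exists_smooth_profile hL0 hL
  have hrρ : r < ρ := hra.trans (hab.trans hbρ)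
  have hω := unitBallVolume_pos (n := n)
  have hpow : 0 ≤ ρ ^ n - r ^ n := sub_nonneg.2 (pow_le_pow_left₀ hr hrρ.le n)
  set u : E n → ℝ := fun x => ψ ‖x - c‖ with hu
  have hone : ∀ x ∈ Metric.ball c a, u =ᶠ[𝓝 x] fun _ => 1 := fun x hx => by
    filter_upwards [Metric.isOpen_ball.mem_nhds hx] with y hy
    exact hψ1 _ (mem_ball_iff_norm.1 hy).le
  have hsmooth : ContDiff ℝ ((⊤ : ℕ∞) : WithTop ℕ∞) u := by
    refine contDiff_iff_contDiffAt.2 fun x => ?_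
    -- The norm is not smooth at the centre, but u is constant near it because a > r ≥ 0.
    by_cases hx : x = c
    · subst hx
      exact contDiffAt_const.congr_of_eventuallyEq
        (hone x (Metric.mem_ball_self (hr.trans_lt hra)))
    · exact hψ.contDiffAt.comp x ((contDiffAt_id.sub contDiffAt_const).norm ℝ (sub_ne_zero.2 hx))
  have htsupp : tsupport u ⊆ Metric.closedBall c b := by
    refine closure_minimal (fun x hx => ?_) Metric.isClosed_closedBall
    by_contra hxb
    rw [mem_closedBall_iff_norm, not_le] at hxb
    exact hx (hψ0 _ hxb.le)
  have hbρ' : Metric.closedBall c b ⊆ Metric.ball c ρ := Metric.closedBall_subset_ball hbρ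
  have htest : IsTestFunction Ω u :=
    ⟨hsmooth, (isCompact_closedBall c b).of_isClosed_subset (isClosed_tsupport u) htsupp,
      htsupp.trans (hbρ'.trans hρΩ)⟩
  have hadm : IsAdmissible n 1 (Metric.closedBall c r) Ω u (gradient u) := by
    refine ⟨htest.memH01 hn hΩ, Metric.ball c a, Metric.isOpen_ball,
      Metric.closedBall_subset_ball hra,
      (Metric.ball_subset_ball (hab.trans hbρ).le).trans hρΩ, Eventually.of_forall fun x hx => ?_⟩
    exact (hψ1 _ (mem_ball_iff_norm.1 hx).le).ge
  have hlip : LipschitzWith L.toNNReal u := by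
    have h1 : LipschitzWith 1 fun x : E n => ‖x - c‖ := by
      simpa [dist_eq_norm] using LipschitzWith.dist_left c
    have h2 := hψL.comp h1
    rwa [mul_one] at h2
  have hgrad : ∀ x ∈ Ω, ‖gradient u x‖ₑ ≤ ENNReal.ofReal L := fun x _ => by
    rw [← ofReal_norm, norm_gradient]
    refine ENNReal.ofReal_le_ofReal ?_
    simpa [hL0.le] using norm_fderiv_le_of_lipschitz ℝ (x₀ := x) hlip
  have hvol : volume {x | x ∈ Ω ∧ gradient u x ≠ 0} ≤
      ENNReal.ofReal (unitBallVolume n * (ρ ^ n - r ^ n)) := by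
    rw [← volume_annulus (by omega) c hr hrρ.le]
    refine measure_mono fun x hx => ?_
    by_contra hxA
    refine hx.2 ?_
    by_cases hxr : ‖x - c‖ ≤ r
    · have : gradient u x = gradient (fun _ => (1 : ℝ)) x :=
        (hone x (mem_ball_iff_norm.2 (hxr.trans_lt hra))).gradient_eq
      rw [this]
      simp [gradient]
    · have hx : x ∉ tsupport u := fun hxs =>
        hxA ⟨not_le.1 hxr, mem_ball_iff_norm.1 (hbρ' (htsupp hxs))⟩
      rw [gradient, fderiv_of_notMem_tsupport ℝ hx, map_zero]
  have hn0 : n ≠ 0 := by omega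
  have hq := lorentzQuasinorm_le_of_enorm_le (p := n) (by positivity) hL0.le (by positivity)
    hgrad hvol
  calc relCapacity n 1 (Metric.closedBall c r) Ω
      ≤ lorentzQuasinorm n 1 Ω (gradient u) ^ (n : ℝ) := sInf_le ⟨u, gradient u, hadm, rfl⟩
    _ ≤ ENNReal.ofReal (L * (n * (unitBallVolume n * (ρ ^ n - r ^ n)) ^ (1 / (n : ℝ)))) ^
          (n : ℝ) := by gcongr
    _ = _ := by
        rw [ENNReal.rpow_natCast, ← ENNReal.ofReal_pow (by positivity), mul_pow, mul_pow, one_div,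
          Real.rpow_inv_natCast_pow (by positivity) hn0]
        congr 1
        ring

theorem relCapacity_closedBall_le (hn : 2 ≤ n) (hΩ : volume Ω ≠ ∞) (hr : 0 ≤ r) (hrρ : r < ρ)
    (hρΩ : Metric.ball c ρ ⊆ Ω) :
    relCapacity n 1 (Metric.closedBall c r) Ω ≤
      ENNReal.ofReal ((n : ℝ) ^ n * unitBallVolume n * ((ρ ^ n - r ^ n) / (ρ - r) ^ n)) := by
  have hpos : 0 < ρ - r := sub_pos.2 hrρ
  have hlim : Tendsto (fun L : ℝ => ENNReal.ofReal
      ((n : ℝ) ^ n * unitBallVolume n * ((ρ ^ n - r ^ n) * L ^ n))) (𝓝[>] (1 / (ρ - r)))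
      (𝓝 (ENNReal.ofReal
        ((n : ℝ) ^ n * unitBallVolume n * ((ρ ^ n - r ^ n) * (1 / (ρ - r)) ^ n)))) := by
    refine Tendsto.mono_left (Continuous.tendsto ?_ _) nhdsWithin_le_nhds
    exact ENNReal.continuous_ofReal.comp (by fun_prop)
  rw [div_eq_mul_inv (ρ ^ n - r ^ n), ← inv_pow, ← one_div]
  -- The slope 1/(ρ - r) itself is not available to a smooth profile, hence the limit from above.
  refine ge_of_tendsto hlim ?_
  filter_upwards [self_mem_nhdsWithin] with L hL
  have hL' : 1 / (ρ - r) < L := hL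
  have hL0 : 0 < L := (by positivity : (0 : ℝ) < 1 / (ρ - r)).trans hL'
  exact relCapacity_closedBall_le_of_lipschitz hn hΩ hr hρΩ hL0 ((one_div_lt hpos hL0).1 hL')

end UpperBound

/-! ### The constant for the unit ball, and the theorem. -/

/-- Apply R - r ≤ (1 - r^n) R to n - 1 of the factors, then R^(n-1) (R - r) ≤ R^n - r^n. This
supplies κ = (1 - r^n)^(n-1). -/
theorem sub_pow_le_mul_sub_pow {n : ℕ} (hn : 1 ≤ n) {r R : ℝ} (hr : 0 ≤ r) (hr1 : r ≤ 1)
    (hrR : r ≤ R) (hR1 : R ≤ 1) :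
    (R - r) ^ n ≤ (1 - r ^ n) ^ (n - 1) * (R ^ n - r ^ n) := by
  obtain ⟨m, rfl⟩ : ∃ m, n = m + 1 := ⟨n - 1, by omega⟩
  have hR : 0 ≤ R := hr.trans hrR
  have h1 : r ^ (m + 1) * R ≤ r := calc
    r ^ (m + 1) * R ≤ r ^ (m + 1) * 1 := by gcongr
    _ = r ^ (m + 1) := mul_one _
    _ ≤ r := pow_le_of_le_one hr hr1 (by omega)
  have h2 : R ^ m * (R - r) ≤ R ^ (m + 1) - r ^ (m + 1) := by
    have : r ^ m * r ≤ R ^ m * r := by gcongr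
    rw [pow_succ, pow_succ]
    linarith
  have h3 : 0 ≤ 1 - r ^ (m + 1) := sub_nonneg.2 (pow_le_one₀ hr hr1)
  have h4 : 0 ≤ R - r := sub_nonneg.2 hrR
  calc (R - r) ^ (m + 1) = (R - r) ^ m * (R - r) := pow_succ _ _
    _ ≤ ((1 - r ^ (m + 1)) * R) ^ m * (R - r) := by
        gcongr
        linarith
    _ = (1 - r ^ (m + 1)) ^ m * (R ^ m * (R - r)) := by rw [mul_pow, mul_assoc]
    _ ≤ (1 - r ^ (m + 1)) ^ m * (R ^ (m + 1) - r ^ (m + 1)) := by gcongr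

end SobolevLorentz

theorem mainTheorem1 (n : ℕ) (hn : 2 ≤ n) :
    (∀ r : ℝ, 0 ≤ r → r < 1 →
      ENNReal.ofReal
          ((n : ℝ) ^ n * SobolevLorentz.unitBallVolume n * (1 - r ^ n) ^ (1 - (n : ℤ))) ≤
        SobolevLorentz.relCapacity (n : ℝ) 1
          (Metric.closedBall (0 : EuclideanSpace ℝ (Fin n)) r) (Metric.ball 0 1) ∧
      SobolevLorentz.relCapacity (n : ℝ) 1
          (Metric.closedBall (0 : EuclideanSpace ℝ (Fin n)) r) (Metric.ball 0 1) ≤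
        ENNReal.ofReal
          ((n : ℝ) ^ n * SobolevLorentz.unitBallVolume n * ((1 - r ^ n) / (1 - r) ^ n))) ∧
    (∀ (x : EuclideanSpace ℝ (Fin n)) (Ω : Set (EuclideanSpace ℝ (Fin n))),
      IsOpen Ω → Bornology.IsBounded Ω → x ∈ Ω →
        SobolevLorentz.relCapacity (n : ℝ) 1 {x} Ω =
          ENNReal.ofReal ((n : ℝ) ^ n * SobolevLorentz.unitBallVolume n)) := by
  have hn1 : 1 ≤ n := by omega
  have hn0 : n ≠ 0 := by omega
  refine ⟨fun r hr hr1 => ⟨?_, ?_⟩, fun x Ω hΩ hb hx => le_antisymm ?_ ?_⟩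
  · have hpos : 0 < 1 - r ^ n := sub_pos.2 (pow_lt_one₀ hr hr1 hn0)
    have h := SobolevLorentz.le_relCapacity_closedBall (n := n) (c := 0) (Ω := Metric.ball 0 1)
      (κ := (1 - r ^ n) ^ (n - 1)) hn1 hr (by positivity) Metric.isOpen_ball
      measure_ball_lt_top.ne fun R hrR hR => by
        refine SobolevLorentz.sub_pow_le_mul_sub_pow hn1 hr hr1.le hrR.le ?_
        have hsub : Metric.ball 0 1 \ Metric.closedBall 0 r ⊆ SobolevLorentz.annulus (n := n) 0 r 1 :=
          fun y hy => by
            rw [Set.mem_sdiff, mem_ball_iff_norm, mem_closedBall_iff_norm, not_le] at hy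
            exact ⟨hy.2, hy.1⟩
        -- Comparing volumes with the annulus between radii r and 1 forces R ≤ 1.
        have hle := hR.trans (measure_mono hsub)
        have hω := SobolevLorentz.unitBallVolume_pos (n := n)
        rw [SobolevLorentz.volume_annulus hn1 0 hr hr1.le, one_pow,
          ENNReal.ofReal_le_ofReal_iff (by positivity), mul_le_mul_iff_right₀ hω] at hle
        exact (pow_le_one_iff_of_nonneg (hr.trans hrR.le) hn0).1 (by linarith)
    have hz : (1 - r ^ n) ^ (1 - (n : ℤ)) = ((1 - r ^ n) ^ (n - 1))⁻¹ := by
      rw [← zpow_natCast (1 - r ^ n), ← zpow_neg]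
      congr 1
      omega
    rw [hz, ← div_eq_mul_inv]
    exact h
  · simpa using SobolevLorentz.relCapacity_closedBall_le (n := n) (c := 0) (ρ := 1)
      (Ω := Metric.ball 0 1) hn measure_ball_lt_top.ne hr hr1 subset_rfl
  · obtain ⟨ρ, hρ, hρΩ⟩ := Metric.isOpen_iff.1 hΩ x hx
    have h := SobolevLorentz.relCapacity_closedBall_le hn hb.measure_lt_top.ne le_rfl hρ hρΩ
    -- At r = 0 the quotient ρ^n / ρ^n is 1, so any ball around x inside Ω gives the sharp constant.
    rwa [Metric.closedBall_zero, zero_pow hn0, sub_zero, sub_zero, div_self (pow_pos hρ n).ne',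
      mul_one] at h
  -- At r = 0 the condition on κ reads R^n ≤ κ R^n, so κ = 1 works whatever the shape of Ω.
  · have h := SobolevLorentz.le_relCapacity_closedBall (c := x) (κ := 1) hn1 le_rfl one_pos hΩ
      hb.measure_lt_top.ne fun R _ _ => by simp [hn0]
    rwa [Metric.closedBall_zero, div_one] at h
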